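/- Let $d\ge 2$ and let $T$ be the $d$-regular rooted tree, whose vertices are the finite words over $\{0,\dots,d-1\}$; $\mathrm{Aut}(T)$ is the group of bijections of the set of words preserving length and prefixes. For $H\le \mathrm{Aut}(T)$ and a vertex $v$, let $\mathrm{Stab}_H(v)$ be the stabilizer of $v$, let $\mathrm{Stab}_H(n)$ be the pointwise stabilizer of the $n$-th level (the words of length $n$), and let the section $\varphi_v(H)\le\mathrm{Aut}(T)$ be the group of restrictions of the elements of $\mathrm{Stab}_H(v)$ to the subtree $T_v$ of words with prefix $v$, where $T_v$ is identified with $T$ by deleting the prefix $v$. Let $\mathrm{Rist}_H(v)$ be the subgroup of the elements of $H$ that fix every vertex outside $T_v$, and let $\mathrm{Rist}_H(n)=\langle \mathrm{Rist}_H(v) : v \text{ of level } n\rangle$. Let $G\le\mathrm{Aut}(T)$ be a finitely generated group such that: (a) $G$ is self-similar: $\varphi_v(G)\le G$ for every vertex $v$; (b) $G$ is branch: for every $n$, $G$ acts transitively on the $n$-th level and $\mathrm{Rist}_G(n)$ has finite index in $G$; (c) $G$ has the congruence subgroup property: every subgroup of finite index in $G$ contains $\mathrm{Stab}_G(n)$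 for some $n$; (d) $G$ has the subgroup induction property: every inductive family $\mathcal X$ of subgroups of $G$ contains every finitely generated subgroup of $G$. Here $\mathcal X$ is called inductive if (I) $\{1\}\in\mathcal X$ and $G\in\mathcal X$; (II) whenever $H\le L\le G$ and $[L:H]<\infty$, one has $L\in\mathcal X$ if and only if $H\in\mathcal X$; (III) whenever $H\le\mathrm{Stab}_G(1)$ (the stabilizer of the first level) is finitely generated and $\varphi_v(H)\in\mathcal X$ for every vertex $v$ of the first level, one has $H\in\mathcal X$. Then $G$ is subgroup separable (LERF): every finitely generated subgroup of $G$ is closed in the profinite topology of $G$, i.e. the topology generated by the cosets of the subgroups of finite index in $G$. -/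

import Mathlib

/-- The automorphism group of the `d`-regular rooted tree. The vertices of the tree are the finite
words over the alphabet `Fin d`, the root is the empty word, and the automorphisms are the
bijections of the set of words that preserve length and prefixes. -/
def treeAut (d : ℕ) : Subgroup (Equiv.Perm (List (Fin d))) where
  carrier := {g | (∀ u, (g u).length = u.length) ∧ ∀ u v, u <+: v → g u <+: g v}
  one_mem' := ⟨fun _ => rfl, fun _ _ h => h⟩
  mul_mem' {g h} hg hh :=
    ⟨fun u => (hg.1 (h u)).trans (hh.1 u), fun u v huv => hg.2 _ _ (hh.2 u v huv)⟩
  inv_mem' {g} hg := by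
    have hlen : ∀ u, (g⁻¹ u).length = u.length := fun u => by
      have h := hg.1 (g⁻¹ u)
      rw [show g (g⁻¹ u) = u from g.apply_symm_apply u] at h
      exact h.symm
    refine ⟨hlen, fun u v huv => ?_⟩
    have h1 : g ((g⁻¹ v).take u.length) <+: v := by
      have h := hg.2 _ _ (List.take_prefix u.length (g⁻¹ v))
      rwa [show g (g⁻¹ v) = v from g.apply_symm_apply v] at h
    have h2 : (g ((g⁻¹ v).take u.length)).length = u.length := by
      rw [hg.1, List.length_take, hlen, Nat.min_eq_left huv.length_le]
    have h3 : g ((g⁻¹ v).take u.length) = u :=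
      (List.prefix_of_prefix_length_le h1 huv h2.le).eq_of_length h2
    have h4 : g⁻¹ u = (g⁻¹ v).take u.length := (Equiv.symm_apply_eq g).mpr h3.symm
    rw [h4]
    exact List.take_prefix _ _

/-- The pointwise stabilizer, in the full automorphism group, of the `n`-th level of the tree. -/
def levelStab (d n : ℕ) : Subgroup (treeAut d) :=
  fixingSubgroup (treeAut d) {v : List (Fin d) | v.length = n}

theorem append_drop_smul_of_stab {d : ℕ} (v : List (Fin d))
    (g : MulAction.stabilizer (treeAut d) v) (w : List (Fin d)) :
    v ++ ((g : treeAut d) • (v ++ w)).drop v.length = (g : treeAut d) • (v ++ w) := by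
  have h : (g : treeAut d) • v <+: (g : treeAut d) • (v ++ w) :=
    (g : treeAut d).2.2 _ _ (List.prefix_append v w)
  rw [MulAction.mem_stabilizer_iff.mp g.2] at h
  obtain ⟨t, ht⟩ := h
  rw [← ht, List.drop_left]

/-- The homomorphism `φ_v` that sends an automorphism fixing the vertex `v` to its restriction to
the subtree hanging from `v`, this subtree being identified with the whole tree through
`v ++ w ↔ w`. -/
def sectionHom {d : ℕ} (v : List (Fin d)) :
    MulAction.stabilizer (treeAut d) v →* treeAut d where
  toFun g :=
    ⟨{ toFun := fun w => ((g : treeAut d) • (v ++ w)).drop v.length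
       invFun := fun w => (((g⁻¹ : MulAction.stabilizer (treeAut d) v) : treeAut d) •
          (v ++ w)).drop v.length
       left_inv := fun w => by
          beta_reduce
          rw [append_drop_smul_of_stab, Subgroup.coe_inv, inv_smul_smul, List.drop_left]
       right_inv := fun w => by
          beta_reduce
          rw [append_drop_smul_of_stab, Subgroup.coe_inv, smul_inv_smul, List.drop_left] },
      fun w => by
        have h := (g : treeAut d).2.1 (v ++ w)
        change (((g : treeAut d) • (v ++ w)).drop v.length).length = w.length
        change ((g : treeAut d) • (v ++ w)).length = (v ++ w).length at h
        rw [List.length_drop, h, List.length_append, Nat.add_sub_cancel_left],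
      fun u w huw => by
        have h : (g : treeAut d) • (v ++ u) <+: (g : treeAut d) • (v ++ w) :=
          (g : treeAut d).2.2 _ _ ((List.prefix_append_right_inj v).mpr huw)
        exact h.drop v.length⟩
  map_one' := by
    ext1
    refine Equiv.ext fun w => ?_
    change ((1 : treeAut d) • (v ++ w)).drop v.length = w
    rw [one_smul, List.drop_left]
  map_mul' g h := by
    ext1
    refine Equiv.ext fun w => ?_
    change (((g : treeAut d) * (h : treeAut d)) • (v ++ w)).drop v.length =
      ((g : treeAut d) • (v ++ ((h : treeAut d) • (v ++ w)).drop v.length)).drop v.length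
    rw [append_drop_smul_of_stab, mul_smul]

/-- The section `φ_v(H) = φ_v(Stab_H(v))` of a subgroup `H` of the automorphism group of the tree
at the vertex `v`. -/
def sectionAt {d : ℕ} (H : Subgroup (treeAut d)) (v : List (Fin d)) : Subgroup (treeAut d) :=
  (H.subgroupOf (MulAction.stabilizer (treeAut d) v)).map (sectionHom v)

/-- `G` is self-similar: all its sections are subgroups of `G`. -/
def IsSelfSimilar {d : ℕ} (G : Subgroup (treeAut d)) : Prop :=
  ∀ v : List (Fin d), sectionAt G v ≤ G

/-- The rigid stabilizer of the vertex `v` in `G`: the elements of `G` that act trivially outside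
of the subtree hanging from `v`. -/
def rist {d : ℕ} (G : Subgroup (treeAut d)) (v : List (Fin d)) : Subgroup (treeAut d) :=
  G ⊓ fixingSubgroup (treeAut d) {w : List (Fin d) | ¬ v <+: w}

/-- The rigid stabilizer of the `n`-th level in `G`: the subgroup generated by the rigid
stabilizers of the vertices of that level. -/
def levelRist {d : ℕ} (G : Subgroup (treeAut d)) (n : ℕ) : Subgroup (treeAut d) :=
  ⨆ (v : List (Fin d)) (_ : v.length = n), rist G v

/-- `G` is a branch group: it is transitive on every level, and the rigid stabilizer of every
level has finite index in `G`. -/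
structure IsBranch {d : ℕ} (G : Subgroup (treeAut d)) : Prop where
  transitive : ∀ u v : List (Fin d), u.length = v.length → ∃ g ∈ G, g • u = v
  finite_index : ∀ n : ℕ, (levelRist G n).relIndex G ≠ 0

/-- The congruence subgroup property: every subgroup of finite index in `G` contains the
stabilizer in `G` of some level. -/
def HasCongruenceSubgroupProperty {d : ℕ} (G : Subgroup (treeAut d)) : Prop :=
  ∀ H : Subgroup (treeAut d), H ≤ G → H.relIndex G ≠ 0 → ∃ n : ℕ, G ⊓ levelStab d n ≤ H

/-- Inductive families of subgroups of `G`. -/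
structure IsInductiveClass {d : ℕ} (G : Subgroup (treeAut d))
    (X : Set (Subgroup (treeAut d))) : Prop where
  le_of_mem : ∀ H ∈ X, H ≤ G
  bot_mem : ⊥ ∈ X
  self_mem : G ∈ X
  mem_iff_of_finite_index : ∀ H L : Subgroup (treeAut d), H ≤ L → L ≤ G → H.relIndex L ≠ 0 →
    (L ∈ X ↔ H ∈ X)
  mem_of_sections : ∀ H : Subgroup (treeAut d), H ≤ G ⊓ levelStab d 1 → H.FG →
    (∀ v : List (Fin d), v.length = 1 → sectionAt H v ∈ X) → H ∈ X

/-- The subgroup induction property: every inductive family of subgroups of `G` contains all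
finitely generated subgroups of `G`. -/
def HasSubgroupInductionProperty {d : ℕ} (G : Subgroup (treeAut d)) : Prop :=
  ∀ X : Set (Subgroup (treeAut d)), IsInductiveClass G X →
    ∀ H : Subgroup (treeAut d), H ≤ G → H.FG → H ∈ X

/-- The profinite topology on a group: the topology generated by the cosets of the subgroups of
finite index. -/
abbrev profiniteTopology (Γ : Type*) [Group Γ] : TopologicalSpace Γ :=
  TopologicalSpace.generateFrom
    {s : Set Γ | ∃ (N : Subgroup Γ) (g : Γ), N.FiniteIndex ∧ s = (fun x => g * x) '' (N : Set Γ)}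

/-- A group is subgroup separable (LERF) if each of its finitely generated subgroups is closed in
the profinite topology. -/
def IsSubgroupSeparable (Γ : Type*) [Group Γ] : Prop :=
  ∀ H : Subgroup Γ, H.FG → @IsClosed Γ (profiniteTopology Γ) (H : Set Γ)

/-! Let H ≤ G be finitely generated. The subgroups whose sections at some level are all finite or of
finite index in the sections of G form an inductive family, so H has such a level n
(`exists_level_sectionAt_finite_or_relIndex_ne_zero`). Separability passes to overgroups of finite
index and pulls back along injections, so H may be replaced by H ∩ Stab(n), seen in the product of
the sections of G at level n, where each projection is finite or of finite index. Splitting off one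
factor at a time (`isSeparableSubgroup_of_prod`, `isSeparableSubgroup_of_pi`) leaves a question in a
single factor Γ: is N separable when it is normalized by some K ≥ N that is finite or of finite
index? For finite K this follows from residual finiteness.

For K of finite index, Γ is a finitely generated branch group. It is also torsion: an infinite
cyclic subgroup of G would have a section of finite index in a branch group, and branch groups are
not virtually abelian. If N moves a vertex v, a double commutator shows that N contains the
commutator subgroup of K ∩ Rist(v), which has finite index in Rist(v) because finitely generated
torsion abelian groups are finite. At some level, N either moves v or acts trivially below v. Hence
there is M of finite index such that N ∩ M consists of the elements of M fixing every vertex fixed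
by N. This is an intersection of M with vertex stabilizers, so it is separable, and so is its
finite-index overgroup N. -/

/-! ### Indices and homomorphisms -/

theorem Subgroup.FiniteIndex.comap {Γ Δ : Type*} [Group Γ] [Group Δ] {M : Subgroup Δ}
    (hM : M.FiniteIndex) (f : Γ →* Δ) : (M.comap f).FiniteIndex :=
  ⟨by rw [Subgroup.index_comap]; exact Subgroup.isFiniteRelIndex_of_finiteIndex.relIndex_ne_zero⟩

theorem Subgroup.relIndex_map_map_ne_zero {Γ Δ : Type*} [Group Γ] [Group Δ] (f : Γ →* Δ)
    {H L : Subgroup Γ} (h : H.relIndex L ≠ 0) : (H.map f).relIndex (L.map f) ≠ 0 := by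
  rw [← Subgroup.relIndex_comap]
  exact fun h0 => h (Subgroup.relIndex_eq_zero_of_le_left (Subgroup.le_comap_map f H) h0)

theorem Subgroup.finite_of_le {Γ : Type*} [Group Γ] {H L : Subgroup Γ} (hHL : H ≤ L)
    (hL : Finite L) : Finite H :=
  Finite.of_injective _ (Subgroup.inclusion_injective hHL)

theorem Subgroup.finite_or_relIndex_ne_zero_of_le {Γ : Type*} [Group Γ] {H L A : Subgroup Γ}
    (hHL : H ≤ L) (hi : H.relIndex L ≠ 0) (hL : Finite L ∨ L.relIndex A ≠ 0) :
    Finite H ∨ H.relIndex A ≠ 0 :=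
  hL.imp (Subgroup.finite_of_le hHL) fun h => Subgroup.relIndex_ne_zero_trans hi h

/-! ### Separable subgroups of abstract groups -/

/-- A subgroup is separable if it is an intersection of subgroups of finite index. -/
def IsSeparableSubgroup {Γ : Type*} [Group Γ] (H : Subgroup Γ) : Prop :=
  ∀ x, x ∉ H → ∃ M : Subgroup Γ, M.FiniteIndex ∧ H ≤ M ∧ x ∉ M

namespace IsSeparableSubgroup

variable {Γ Δ : Type*} [Group Γ] [Group Δ]

theorem isClosed {H : Subgroup Γ} (hH : IsSeparableSubgroup H) :
    @IsClosed Γ (profiniteTopology Γ) (H : Set Γ) := by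
  let := profiniteTopology Γ
  rw [← isOpen_compl_iff, isOpen_iff_forall_mem_open]
  intro x hx
  obtain ⟨M, hM, hHM, hxM⟩ := hH x hx
  refine ⟨(fun y => x * y) '' (M : Set Γ), ?_,
    TopologicalSpace.isOpen_generateFrom_of_mem ⟨M, x, hM, rfl⟩, 1, M.one_mem, mul_one x⟩
  rintro _ ⟨m, hm, rfl⟩ hmem
  exact hxM ((M.mul_mem_cancel_right hm).mp (hHM hmem))

theorem of_finiteIndex (H : Subgroup Γ) [hH : H.FiniteIndex] : IsSeparableSubgroup H :=
  fun _ hx => ⟨H, hH, le_rfl, hx⟩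

theorem comap {H : Subgroup Δ} (hH : IsSeparableSubgroup H) (f : Γ →* Δ) :
    IsSeparableSubgroup (H.comap f) := fun x hx => by
  obtain ⟨M, hM, hHM, hxM⟩ := hH (f x) hx
  exact ⟨M.comap f, hM.comap f, Subgroup.comap_mono hHM, hxM⟩

theorem inf {H L : Subgroup Γ} (hH : IsSeparableSubgroup H) (hL : IsSeparableSubgroup L) :
    IsSeparableSubgroup (H ⊓ L) := fun x hx => by
  by_cases h : x ∈ H
  · obtain ⟨M, hM, hLM, hxM⟩ := hL x fun h' => hx ⟨h, h'⟩
    exact ⟨M, hM, inf_le_right.trans hLM, hxM⟩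
  · obtain ⟨M, hM, hHM, hxM⟩ := hH x h
    exact ⟨M, hM, inf_le_left.trans hHM, hxM⟩

/-- `L` is a finite union of translates of `H`. Each translate is separated from `x` by its own
subgroup of finite index, and the normal core of their intersection serves all translates at once.
-/
theorem of_relIndex_ne_zero {H L : Subgroup Γ} (hH : IsSeparableSubgroup H) (hHL : H ≤ L)
    (hi : H.relIndex L ≠ 0) : IsSeparableSubgroup L := fun x hx => by
  have : Finite (L ⧸ H.subgroupOf L) := Subgroup.index_ne_zero_iff_finite.mp hi
  have key : ∀ q : L ⧸ H.subgroupOf L, ∃ M : Subgroup Γ, M.FiniteIndex ∧ H ≤ M ∧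
      (q.out : Γ)⁻¹ * x ∉ M := fun q => hH _ fun h => hx <| by
    simpa using L.mul_mem q.out.2 (hHL h)
  choose M hM hHM hxM using key
  have : (⨅ q, M q).FiniteIndex := Subgroup.finiteIndex_iInf hM
  refine ⟨L ⊔ (⨅ q, M q).normalCore, Subgroup.finiteIndex_of_le le_sup_right, le_sup_left,
    fun hxN => ?_⟩
  obtain ⟨l, hl, n, hn, rfl⟩ := Subgroup.mem_sup_of_normal_right.mp hxN
  have hn' := Subgroup.normalCore_le _ hn
  let q : L ⧸ H.subgroupOf L := QuotientGroup.mk ⟨l, hl⟩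
  refine hxM q ?_
  rw [← mul_assoc]
  refine (M q).mul_mem (hHM q ?_) (Subgroup.mem_iInf.mp hn' q)
  have h : q.out⁻¹ * ⟨l, hl⟩ ∈ H.subgroupOf L :=
    QuotientGroup.eq.mp (QuotientGroup.out_eq' q)
  exact h

theorem of_subgroupOf {H D : Subgroup Γ} [hD : D.FiniteIndex] (hHD : H ≤ D)
    (hH : IsSeparableSubgroup (H.subgroupOf D)) : IsSeparableSubgroup H := fun x hx => by
  by_cases hxD : x ∈ D
  · obtain ⟨M, hM, hHM, hxM⟩ := hH ⟨x, hxD⟩ hx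
    refine ⟨M.map D.subtype, ⟨?_⟩, fun h hh => ⟨⟨h, hHD hh⟩, hHM hh, rfl⟩, ?_⟩
    · rw [Subgroup.index_map_subtype]
      exact mul_ne_zero hM.index_ne_zero hD.index_ne_zero
    · rintro ⟨y, hy, hyx⟩
      exact hxM (by rwa [← show y = ⟨x, hxD⟩ from Subtype.ext hyx])
  · exact ⟨D, hD, hHD, hxD⟩

theorem of_map {H : Subgroup Γ} {f : Γ →* Δ} (hf : Function.Injective f)
    (hH : IsSeparableSubgroup (H.map f)) : IsSeparableSubgroup H := by
  rw [← Subgroup.comap_map_eq_self_of_injective hf H]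
  exact hH.comap f

end IsSeparableSubgroup

/-! ### Separability in direct products -/

/-- A criterion for the separability of a subgroup of a direct product of two groups. -/
theorem isSeparableSubgroup_of_prod {A B : Type*} [Group A] [Group B] (H : Subgroup (A × B))
    (hA : IsSeparableSubgroup (H.comap (MonoidHom.inl A B)))
    (hB : ∀ L : Subgroup B, L ≤ H.map (MonoidHom.snd A B) →
      L.relIndex (H.map (MonoidHom.snd A B)) ≠ 0 → IsSeparableSubgroup L) :
    IsSeparableSubgroup H := by
  rintro ⟨x, y⟩ hxy
  by_cases hy : y ∈ H.map (MonoidHom.snd A B)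
  swap
  · obtain ⟨M, hM, hHM, hyM⟩ := hB _ le_rfl (by simp) y hy
    exact ⟨M.comap (MonoidHom.snd A B), hM.comap _, Subgroup.map_le_iff_le_comap.mp hHM, hyM⟩
  obtain ⟨⟨k, y⟩, hk, rfl⟩ := hy
  -- Dividing by `(k, y) ∈ H` reduces the problem to the slice of `H` over `1`.
  obtain ⟨M, hM, hNM, hxM⟩ := hA (x * k⁻¹) fun h => hxy <| by
    have := H.mul_mem h hk
    simpa using this
  let C := M.normalCore
  let C' : Subgroup (A × B) := C.prod ⊥
  have hC' : C'.Normal := Subgroup.prod_normal C ⊥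
  have hmemC : ∀ p : A × B, p ∈ C' ↔ p.1 ∈ C ∧ p.2 = 1 := fun p => by
    simp [C', Subgroup.mem_prod]
  have hCf : ∀ L, (C.comap (MonoidHom.fst A B)).IsFiniteRelIndex L := fun L =>
    have := (inferInstance : C.FiniteIndex).comap (MonoidHom.fst A B)
    Subgroup.isFiniteRelIndex_of_finiteIndex
  let L₀ : Subgroup B := (H ⊓ C.comap (MonoidHom.fst A B)).map (MonoidHom.snd A B)
  have hL₀ : IsSeparableSubgroup L₀ := hB L₀ (Subgroup.map_mono inf_le_left) <|
    Subgroup.relIndex_map_map_ne_zero _ <| by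
      rw [Subgroup.inf_relIndex_left]
      exact (hCf _).relIndex_ne_zero
  have hCL : IsSeparableSubgroup (C.prod L₀) := by
    have h := ((IsSeparableSubgroup.of_finiteIndex C).comap (MonoidHom.fst A B)).inf
      (hL₀.comap (MonoidHom.snd A B))
    exact h
  -- `C.prod L₀` lies in `H ⊔ C'` and contains all its elements with first coordinate in `C`, so its
  -- index there is finite.
  have hQ : IsSeparableSubgroup (H ⊔ C') := by
    refine hCL.of_relIndex_ne_zero ?_ ?_
    · rintro ⟨a, b⟩ ⟨ha, ⟨⟨a', _⟩, ⟨ha', hac⟩, rfl⟩⟩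
      refine Subgroup.mem_sup_of_normal_right.mpr ⟨_, ha', (a'⁻¹ * a, 1), ?_, ?_⟩
      · exact (hmemC _).mpr ⟨C.mul_mem (C.inv_mem hac) ha, rfl⟩
      · simp
    · have h : (C.comap (MonoidHom.fst A B)).relIndex (H ⊔ C') ≠ 0 := (hCf _).relIndex_ne_zero
      rw [← Subgroup.inf_relIndex_right] at h
      refine fun h0 => h (Subgroup.relIndex_eq_zero_of_le_left ?_ h0)
      rintro p ⟨hp, hpQ⟩
      obtain ⟨q, hq, c, hc, rfl⟩ := Subgroup.mem_sup_of_normal_right.mp hpQ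
      rw [hmemC] at hc
      refine ⟨hp, q, ⟨hq, ?_⟩, ?_⟩
      · exact (C.mul_mem_cancel_right hc.1).mp hp
      · simp [hc.2]
  obtain ⟨M', hM', hQM, hxM'⟩ := hQ (x, y) fun hQ => by
    obtain ⟨q, hq, c, hc, hqc⟩ := Subgroup.mem_sup_of_normal_right.mp hQ
    rw [hmemC] at hc
    refine hxM ?_
    have h1 : q.1 * c.1 = x := congrArg Prod.fst hqc
    have h2 : q.2 = y := by simpa [hc.2] using congrArg Prod.snd hqc
    have h3 : q.1 * k⁻¹ ∈ M := hNM <| by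
      have h := H.mul_mem hq (H.inv_mem hk)
      have h4 : q * (k, y)⁻¹ = (q.1 * k⁻¹, 1) := Prod.ext rfl (by simp [h2])
      rwa [h4] at h
    have h5 : k * c.1 * k⁻¹ ∈ M :=
      Subgroup.normalCore_le M (Subgroup.Normal.conj_mem inferInstance c.1 hc.1 k)
    have h6 := M.mul_mem h3 h5
    rwa [← h1, show q.1 * c.1 * k⁻¹ = q.1 * k⁻¹ * (k * c.1 * k⁻¹) by group]
  exact ⟨M', hM', le_sup_left.trans hQM, hxM'⟩

/-- A subgroup of a finite direct product is separable if its projections are finite or of finite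
index, and if the factors have many separable subgroups. -/
theorem isSeparableSubgroup_of_pi {ι : Type*} [Finite ι] {R : ι → Type*} [∀ i, Group (R i)]
    (hR : ∀ i (K N : Subgroup (R i)), Finite K ∨ K.FiniteIndex → N ≤ K →
      (∀ k ∈ K, ∀ n ∈ N, k * n * k⁻¹ ∈ N) → IsSeparableSubgroup N)
    (H : Subgroup (∀ i, R i))
    (hH : ∀ i, Finite (H.map (Pi.evalMonoidHom R i)) ∨
      (H.map (Pi.evalMonoidHom R i)).FiniteIndex) : IsSeparableSubgroup H := by
  classical
  have := Fintype.ofFinite ι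
  -- Induction on a set `s` of coordinates supporting `H`, inside a fixed ambient product.
  suffices h : ∀ (s : Finset ι) (H : Subgroup (∀ i, R i)),
      (∀ i, Finite (H.map (Pi.evalMonoidHom R i)) ∨
        (H.map (Pi.evalMonoidHom R i)).FiniteIndex) →
      (∀ h ∈ H, ∀ i ∉ s, h i = 1) → IsSeparableSubgroup H from
    h Finset.univ H hH fun _ _ i hi => absurd (Finset.mem_univ i) hi
  clear hH H
  intro s
  induction s using Finset.induction_on with
  | empty =>
    intro H _ hs x hx
    have hx1 : ∃ i, x i ≠ 1 := by
      by_contra! h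
      exact hx ((funext h : x = 1) ▸ H.one_mem)
    obtain ⟨i, hi⟩ := hx1
    have hbot : IsSeparableSubgroup (⊥ : Subgroup (R i)) :=
      hR i ⊥ ⊥ (Or.inl inferInstance) le_rfl (by simp)
    obtain ⟨M, hM, hHM, hxM⟩ := hbot.comap (Pi.evalMonoidHom R i) x (by simpa using hi)
    exact ⟨M, hM, fun h hh => hHM (by simpa using hs h hh i (by simp)), hxM⟩
  | insert i s his IH =>
    intro H hH hs
    -- `t` erases coordinate `i`, so `f` separates it from the others without changing the index
    -- type.
    let t : (∀ j, R j) →* (∀ j, R j) :=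
      MonoidHom.pi fun j => if j = i then 1 else Pi.evalMonoidHom R j
    have ht : ∀ x j, j ≠ i → t x j = x j := fun x j hj => by
      change (if j = i then 1 else Pi.evalMonoidHom R j) x = x j
      rw [if_neg hj]
      rfl
    have hti : ∀ x, t x i = 1 := fun x => by
      change (if i = i then 1 else Pi.evalMonoidHom R i) x = 1
      rw [if_pos rfl]
      rfl
    let f : (∀ j, R j) →* R i × (∀ j, R j) := (Pi.evalMonoidHom R i).prod t
    have hf : Function.Injective f := fun x y hxy => by
      funext j
      by_cases hj : j = i
      · subst hj
        exact congrArg Prod.fst hxy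
      · rw [← ht x j hj, ← ht y j hj]
        exact congrFun (congrArg Prod.snd hxy) j
    refine IsSeparableSubgroup.of_map hf (isSeparableSubgroup_of_prod _ ?_ fun L hL hLi => ?_)
    -- The slice of `H` in `R i` is normalized by the whole projection of `H` to `R i`.
    · refine hR i (H.map (Pi.evalMonoidHom R i)) _ (hH i) ?_ ?_
      · rintro a ⟨x, hx, hxa⟩
        exact ⟨x, hx, congrArg Prod.fst hxa⟩
      · rintro _ ⟨k, hk, rfl⟩ n ⟨x, hx, hxn⟩
        refine ⟨k * x * k⁻¹, H.mul_mem (H.mul_mem hk hx) (H.inv_mem hk), ?_⟩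
        rw [map_mul, map_mul, hxn, map_inv]
        refine Prod.ext rfl ?_
        change t k * 1 * (t k)⁻¹ = 1
        group
    · have hsnd : (H.map f).map (MonoidHom.snd _ _) = H.map t := by
        rw [Subgroup.map_map]
        rfl
      rw [hsnd] at hL hLi
      have hLs : ∀ h ∈ L, ∀ j ∉ s, h j = 1 := fun h hh j hj => by
        obtain ⟨x, hx, rfl⟩ := hL hh
        by_cases hji : j = i
        · subst hji
          exact hti x
        · rw [ht x j hji]
          exact hs x hx j (by simp [hji, hj])
      refine IH L (fun j => ?_) hLs
      by_cases hji : j = i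
      · subst hji
        left
        have : L.map (Pi.evalMonoidHom R j) = ⊥ := by
          rw [Subgroup.map_eq_bot_iff]
          exact fun h hh => hLs h hh j his
        rw [this]
        infer_instance
      · have he : (H.map t).map (Pi.evalMonoidHom R j) = H.map (Pi.evalMonoidHom R j) := by
          rw [Subgroup.map_map]
          congr 1
          exact MonoidHom.ext fun x => ht x j hji
        have h1 := Subgroup.relIndex_map_map_ne_zero (Pi.evalMonoidHom R j) hLi
        have h2 := Subgroup.map_mono (f := Pi.evalMonoidHom R j) hL
        rw [he] at h1 h2
        have h3 := Subgroup.finite_or_relIndex_ne_zero_of_le (A := ⊤) h2 h1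
        simp only [Subgroup.relIndex_top_right, ← Subgroup.finiteIndex_iff] at h3
        exact h3 (hH j)

/-! ### Sections and stabilizers of tree automorphisms -/

section TreeAut

variable {d : ℕ}

theorem treeAut_ext {g h : treeAut d} (H : ∀ w : List (Fin d), g • w = h • w) : g = h :=
  Subtype.ext (Equiv.ext H)

theorem length_treeAut_smul (g : treeAut d) (w : List (Fin d)) : (g • w).length = w.length :=
  g.2.1 w

theorem treeAut_smul_append (g : treeAut d) (u w : List (Fin d)) :
    ∃ t, g • (u ++ w) = g • u ++ t ∧ t.length = w.length := by
  obtain ⟨t, ht⟩ : g • u <+: g • (u ++ w) := g.2.2 _ _ (List.prefix_append u w)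
  refine ⟨t, ht.symm, ?_⟩
  have := congrArg List.length ht
  simp only [List.length_append, length_treeAut_smul] at this
  omega

theorem treeAut_smul_left_of_append {g : treeAut d} {u w u' w' : List (Fin d)}
    (h : g • (u ++ w) = u' ++ w') (hu : u.length = u'.length) : g • u = u' := by
  obtain ⟨t, ht, -⟩ := treeAut_smul_append g u w
  exact (List.append_inj (ht.symm.trans h) ((length_treeAut_smul g u).trans hu)).1

theorem mem_levelStab {n : ℕ} {g : treeAut d} :
    g ∈ levelStab d n ↔ ∀ v : List (Fin d), v.length = n → g • v = v := by
  simp [levelStab, mem_fixingSubgroup_iff]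

theorem levelStab_le_stabilizer {n : ℕ} {v : List (Fin d)} (hv : v.length = n) :
    levelStab d n ≤ MulAction.stabilizer (treeAut d) v := fun _ hg => mem_levelStab.mp hg v hv

theorem exists_append_of_length_le {n : ℕ} {v : List (Fin d)} (hv : n ≤ v.length) :
    ∃ u w, u.length = n ∧ v = u ++ w :=
  ⟨v.take n, v.drop n, by simp [hv], (List.take_append_drop n v).symm⟩

theorem mem_sectionAt {H : Subgroup (treeAut d)} {v : List (Fin d)} {k : treeAut d} :
    k ∈ sectionAt H v ↔ ∃ g ∈ H, g • v = v ∧ ∀ w, g • (v ++ w) = v ++ k • w := by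
  constructor
  · rintro ⟨g, hg, rfl⟩
    exact ⟨g, hg, g.2, fun w => (append_drop_smul_of_stab v g w).symm⟩
  · rintro ⟨g, hg, hv, h⟩
    refine ⟨⟨g, hv⟩, hg, treeAut_ext fun w => ?_⟩
    exact List.append_cancel_left ((append_drop_smul_of_stab v ⟨g, hv⟩ w).trans (h w))

theorem exists_mem_sectionAt {H : Subgroup (treeAut d)} {v : List (Fin d)} {g : treeAut d}
    (hg : g ∈ H) (hv : g • v = v) : ∃ k ∈ sectionAt H v, ∀ w, g • (v ++ w) = v ++ k • w :=
  ⟨sectionHom v ⟨g, hv⟩, ⟨⟨g, hv⟩, hg, rfl⟩,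
    fun w => (append_drop_smul_of_stab v ⟨g, hv⟩ w).symm⟩

theorem sectionAt_mono {H L : Subgroup (treeAut d)} (h : H ≤ L) (v : List (Fin d)) :
    sectionAt H v ≤ sectionAt L v :=
  Subgroup.map_mono (Subgroup.comap_mono h)

theorem sectionAt_append (H : Subgroup (treeAut d)) (v w : List (Fin d)) :
    sectionAt H (v ++ w) = sectionAt (sectionAt H v) w := by
  ext k
  constructor
  · intro hk
    obtain ⟨g, hg, hvw, h⟩ := mem_sectionAt.mp hk
    obtain ⟨k', hk', h'⟩ := exists_mem_sectionAt hg (treeAut_smul_left_of_append hvw rfl)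
    refine mem_sectionAt.mpr ⟨k', hk', ?_, fun x => ?_⟩
    · exact List.append_cancel_left ((h' w).symm.trans hvw)
    · have := h x
      rw [List.append_assoc, h', List.append_assoc] at this
      exact List.append_cancel_left this
  · intro hk
    obtain ⟨k', hk', hw, h⟩ := mem_sectionAt.mp hk
    obtain ⟨g, hg, -, h'⟩ := mem_sectionAt.mp hk'
    exact mem_sectionAt.mpr ⟨g, hg, by rw [h', hw], fun x => by
      rw [List.append_assoc, h', h, List.append_assoc]⟩

theorem relIndex_sectionAt_ne_zero {H L : Subgroup (treeAut d)} (h : H.relIndex L ≠ 0)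
    (v : List (Fin d)) : (sectionAt H v).relIndex (sectionAt L v) ≠ 0 :=
  Subgroup.relIndex_map_map_ne_zero _ (Subgroup.relIndex_comap_ne_zero _ h)

theorem finite_sectionAt {H : Subgroup (treeAut d)} (hH : Finite H) (v : List (Fin d)) :
    Finite (sectionAt H v) := by
  have : Finite (H.subgroupOf (MulAction.stabilizer (treeAut d) v)) :=
    Finite.of_injective (fun g => (⟨g.1, g.2⟩ : H)) fun a b h =>
      Subtype.ext (Subtype.ext (congrArg (fun x : H => (x : treeAut d)) h))
  exact Finite.of_surjective _ (MonoidHom.subgroupMap_surjective (sectionHom v) _)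

/-- The automorphisms that fix the vertex `v` and whose section at `v` belongs to `S`. -/
def sectionComap (v : List (Fin d)) (S : Subgroup (treeAut d)) : Subgroup (treeAut d) :=
  (S.comap (sectionHom v)).map (MulAction.stabilizer (treeAut d) v).subtype

theorem exists_of_mem_sectionComap {v : List (Fin d)} {S : Subgroup (treeAut d)} {g : treeAut d}
    (hg : g ∈ sectionComap v S) : ∃ k ∈ S, ∀ w, g • (v ++ w) = v ++ k • w := by
  obtain ⟨g, hg, rfl⟩ := hg
  exact ⟨_, hg, fun w => (append_drop_smul_of_stab v g w).symm⟩

theorem relIndex_sectionComap_ne_zero {v : List (Fin d)} {S L : Subgroup (treeAut d)}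
    (hL : L ≤ MulAction.stabilizer (treeAut d) v) (h : S.relIndex (sectionAt L v) ≠ 0) :
    (sectionComap v S).relIndex L ≠ 0 := by
  rw [← Subgroup.map_subgroupOf_eq_of_le hL, sectionComap,
    Subgroup.relIndex_map_map_of_injective _ _ (Subgroup.subtype_injective _),
    Subgroup.relIndex_comap]
  exact h

instance finiteIndex_stabilizer_treeAut (v : List (Fin d)) :
    (MulAction.stabilizer (treeAut d) v).FiniteIndex := ⟨by
  rw [MulAction.index_stabilizer]
  have hf : (MulAction.orbit (treeAut d) v).Finite :=
    (List.finite_length_eq (Fin d) v.length).subset <| by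
      rintro _ ⟨g, rfl⟩
      exact length_treeAut_smul g v
  exact (Set.ncard_pos hf).mpr (MulAction.nonempty_orbit v) |>.ne'⟩

instance finiteIndex_levelStab (n : ℕ) : (levelStab d n).FiniteIndex := by
  have : Finite {v : List (Fin d) // v.length = n} := List.finite_length_eq (Fin d) n
  have h : (⨅ v : {v : List (Fin d) // v.length = n},
      MulAction.stabilizer (treeAut d) v.1).FiniteIndex :=
    Subgroup.finiteIndex_iInf fun _ => inferInstance
  refine @Subgroup.finiteIndex_of_le _ _ _ _ h fun g hg => mem_levelStab.mpr fun v hv => ?_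
  exact Subgroup.mem_iInf.mp hg ⟨v, hv⟩

/-! ### Sections under subgroup induction -/

/-- At some level, all the sections of a finitely generated subgroup of a self-similar group with
the subgroup induction property are finite or of finite index. -/
theorem exists_level_sectionAt_finite_or_relIndex_ne_zero {G : Subgroup (treeAut d)}
    (hss : IsSelfSimilar G) (hind : HasSubgroupInductionProperty G) {H : Subgroup (treeAut d)}
    (hHG : H ≤ G) (hH : H.FG) : ∃ n, ∀ v : List (Fin d), v.length = n →
      Finite (sectionAt H v) ∨ (sectionAt H v).relIndex (sectionAt G v) ≠ 0 := by
  -- The alternative persists at deeper levels, so the levels found for the finitely many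
  -- first-level sections can be replaced by a common one.
  have up : ∀ (H : Subgroup (treeAut d)) (v w : List (Fin d)),
      (Finite (sectionAt H v) ∨ (sectionAt H v).relIndex (sectionAt G v) ≠ 0) →
      Finite (sectionAt H (v ++ w)) ∨
        (sectionAt H (v ++ w)).relIndex (sectionAt G (v ++ w)) ≠ 0 := fun H v w h => by
    rw [sectionAt_append, sectionAt_append]
    exact h.imp (fun h => finite_sectionAt h w) fun h => relIndex_sectionAt_ne_zero h w
  let X : Set (Subgroup (treeAut d)) := {H | H ≤ G ∧ ∃ n, ∀ v : List (Fin d), v.length = n →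
      Finite (sectionAt H v) ∨ (sectionAt H v).relIndex (sectionAt G v) ≠ 0}
  have hX : IsInductiveClass G X := by
    refine ⟨fun H hH => hH.1, ⟨bot_le, 0, fun v _ => Or.inl (finite_sectionAt inferInstance v)⟩,
      ⟨le_rfl, 0, fun v _ => Or.inr (by simp)⟩, fun H L hHL hLG hi => ⟨?_, ?_⟩,
      fun H hHG _ hsec => ?_⟩
    · rintro ⟨-, n, hn⟩
      exact ⟨hHL.trans hLG, n, fun v hv => Subgroup.finite_or_relIndex_ne_zero_of_le
        (sectionAt_mono hHL v) (relIndex_sectionAt_ne_zero hi v) (hn v hv)⟩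
    · rintro ⟨-, n, hn⟩
      refine ⟨hLG, n, fun v hv => (hn v hv).imp (fun hf => ?_) fun h h0 => ?_⟩
      · have h := relIndex_sectionAt_ne_zero hi v
        have h' := Subgroup.relIndex_ne_zero_trans (H := ⊥) (by
          rw [Subgroup.relIndex_bot_left]
          exact (@Nat.card_pos _ _ hf).ne') h
        rw [Subgroup.relIndex_bot_left] at h'
        exact Nat.finite_of_card_ne_zero h'
      · exact h (Subgroup.relIndex_eq_zero_of_le_left (sectionAt_mono hHL v) h0)
    · choose! f hf using fun v hv => (hsec v hv).2
      have hfin := List.finite_length_eq (Fin d) 1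
      obtain ⟨N, hN⟩ := (hfin.image f).bddAbove
      refine ⟨hHG.trans inf_le_left, 1 + N, fun v hv => ?_⟩
      obtain ⟨u, w, hu, rfl⟩ := exists_append_of_length_le (n := 1) (v := v) (by omega)
      have hNu := hN ⟨u, hu, rfl⟩
      obtain ⟨w, w', hw, rfl⟩ := exists_append_of_length_le (n := f u) (v := w) (by
        simp only [List.length_append] at hv
        omega)
      rw [← List.append_assoc]
      refine up H _ w' ?_
      rw [sectionAt_append]
      -- The index is finite in the section of `G` at `w`, which by self-similarity contains the
      -- section of `G` at `u ++ w`.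
      refine (hf u hu w hw).imp_right fun h h0 => h ?_
      refine Subgroup.relIndex_eq_zero_of_le_right ?_ h0
      rw [sectionAt_append]
      exact sectionAt_mono (hss u) w
  exact (hind X hX H hHG hH).2

end TreeAut

/-! ### Finite-index and torsion preliminaries -/

section FiniteIndex

variable {Γ : Type*} [Group Γ]

theorem Subgroup.fg_of_relIndex_ne_zero {H L : Subgroup Γ} (hHL : H ≤ L) (h : H.relIndex L ≠ 0)
    (hL : L.FG) : H.FG := by
  have := (Group.fg_iff_subgroup_fg L).mpr hL
  have : (H.subgroupOf L).FiniteIndex := ⟨h⟩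
  have hfg : Group.FG (H.subgroupOf L) := Subgroup.fg_of_index_ne_zero _
  exact (Group.fg_iff_subgroup_fg H).mp (Group.fg_of_surjective
    (f := (Subgroup.subgroupOfEquivOfLe hHL).toMonoidHom) (Subgroup.subgroupOfEquivOfLe hHL).surjective)

theorem Subgroup.relIndex_commutator_ne_zero {Q : Subgroup Γ} (hfg : Q.FG)
    (htor : ∀ q ∈ Q, IsOfFinOrder q) : ⁅Q, Q⁆.relIndex Q ≠ 0 := by
  have := (Group.fg_iff_subgroup_fg Q).mpr hfg
  have hfin : Finite (Abelianization Q) := by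
    have : Group.FG (Abelianization Q) :=
      Group.fg_of_surjective (f := Abelianization.of) QuotientGroup.mk_surjective
    refine CommGroup.finite_of_fg_isMulTorsion _ fun x => ?_
    obtain ⟨q, rfl⟩ := QuotientGroup.mk_surjective x
    have hq : IsOfFinOrder q := Submonoid.isOfFinOrder_coe.mp (htor q q.2)
    exact Abelianization.of.isOfFinOrder hq
  have hi : (_root_.commutator Q).index ≠ 0 := Subgroup.index_ne_zero_iff_finite.mpr hfin
  refine fun h0 => hi (Nat.eq_zero_of_zero_dvd (h0 ▸ Subgroup.index_dvd_of_le ?_))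
  rw [_root_.commutator_def, Subgroup.commutator_le]
  intro a _ b _
  exact Subgroup.commutator_mem_commutator a.2 b.2

theorem Subgroup.exists_ne_one_of_relIndex_ne_zero {A H : Subgroup Γ} (hH : Infinite H)
    (h : A.relIndex H ≠ 0) : ∃ a ∈ A, a ∈ H ∧ a ≠ 1 := by
  by_contra! hA
  have hbot : A ⊓ H = ⊥ := (Subgroup.eq_bot_iff_forall _).mpr fun a ha => hA a ha.1 ha.2
  rw [← Subgroup.inf_relIndex_right, hbot, Subgroup.relIndex_bot_left] at h
  exact h Nat.card_eq_zero_of_infinite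

theorem Subgroup.finite_of_relIndex_ne_zero {A H : Subgroup Γ} (hA : Finite A)
    (h : A.relIndex H ≠ 0) : Finite H := by
  by_contra hH
  rw [not_finite_iff_infinite] at hH
  have h' := Subgroup.relIndex_ne_zero_trans (H := ⊥) (K := A) (by
    rw [Subgroup.relIndex_bot_left]
    exact (@Nat.card_pos _ _ hA).ne') h
  rw [Subgroup.relIndex_bot_left] at h'
  exact h' Nat.card_eq_zero_of_infinite

end FiniteIndex

/-! ### Rigid stabilizers and branch groups -/

section Branch

variable {d : ℕ}

/-- Padding makes every word a prefix of one of length at least `n`; this needs a letter, hence `0 <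
d`. -/
theorem treeAut_ext_of_level (hd : 0 < d) {g h : treeAut d} (n : ℕ)
    (H : ∀ v w : List (Fin d), v.length = n → g • (v ++ w) = h • (v ++ w)) : g = h := by
  refine treeAut_ext fun w => ?_
  obtain ⟨u, u', hu, hw⟩ := exists_append_of_length_le (n := n)
    (v := w ++ List.replicate n ⟨0, hd⟩) (by simp)
  have h1 := H u u' hu
  rw [← hw] at h1
  obtain ⟨t, ht, -⟩ := treeAut_smul_append h w (List.replicate n ⟨0, hd⟩)
  exact treeAut_smul_left_of_append (h1.trans ht) (length_treeAut_smul h w).symm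

theorem mem_sectionComap_of {v : List (Fin d)} {S : Subgroup (treeAut d)} {g k : treeAut d}
    (hv : g • v = v) (hk : k ∈ S) (h : ∀ w, g • (v ++ w) = v ++ k • w) :
    g ∈ sectionComap v S := by
  refine ⟨⟨g, hv⟩, ?_, rfl⟩
  rw [SetLike.mem_coe, Subgroup.mem_comap]
  convert! hk
  exact treeAut_ext fun w => List.append_cancel_left
    ((append_drop_smul_of_stab v ⟨g, hv⟩ w).trans (h w))

theorem mem_rist {Γ : Subgroup (treeAut d)} {v : List (Fin d)} {g : treeAut d} :
    g ∈ rist Γ v ↔ g ∈ Γ ∧ ∀ w, ¬ v <+: w → g • w = w := by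
  simp [rist, mem_fixingSubgroup_iff]

theorem not_prefix_append_of_ne {u v : List (Fin d)} (h : u.length = v.length) (huv : u ≠ v)
    (w : List (Fin d)) : ¬ v <+: u ++ w := by
  rintro ⟨t, ht⟩
  exact huv (List.append_inj ht h.symm).1.symm

theorem rist_smul_append {Γ : Subgroup (treeAut d)} {u v : List (Fin d)} {g : treeAut d}
    (hg : g ∈ rist Γ v) (h : u.length = v.length) (huv : u ≠ v) (w : List (Fin d)) :
    g • (u ++ w) = u ++ w :=
  (mem_rist.mp hg).2 _ (not_prefix_append_of_ne h huv w)

theorem rist_le_levelStab (Γ : Subgroup (treeAut d)) (v : List (Fin d)) :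
    rist Γ v ≤ levelStab d v.length := fun g hg => by
  have key : ∀ u, u.length = v.length → u ≠ v → g • u = u := fun u hu huv => by
    simpa using rist_smul_append hg hu huv []
  refine mem_levelStab.mpr fun u hu => ?_
  by_cases huv : u = v
  · subst huv
    by_contra h
    exact h (MulAction.injective g (key _ (length_treeAut_smul g u) h))
  · exact key u hu huv

theorem rist_le_levelRist (Γ : Subgroup (treeAut d)) (v : List (Fin d)) :
    rist Γ v ≤ levelRist Γ v.length := le_iSup₂_of_le v rfl le_rfl

theorem levelRist_le {Γ : Subgroup (treeAut d)} {n : ℕ} : levelRist Γ n ≤ Γ :=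
  iSup₂_le fun _ _ => inf_le_left

theorem levelRist_le_levelStab (Γ : Subgroup (treeAut d)) (n : ℕ) :
    levelRist Γ n ≤ levelStab d n := by
  refine iSup₂_le fun v hv => ?_
  subst hv
  exact rist_le_levelStab Γ v

theorem levelRist_le_sectionComap (Γ : Subgroup (treeAut d)) (v : List (Fin d)) :
    levelRist Γ v.length ≤ sectionComap v (sectionAt (rist Γ v) v) := by
  refine iSup₂_le fun u hu g hg => ?_
  have hgv : g • v = v := mem_levelStab.mp (rist_le_levelStab Γ u hg) v hu.symm
  by_cases huv : v = u
  · subst huv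
    obtain ⟨k, hk, h⟩ := exists_mem_sectionAt hg hgv
    exact mem_sectionComap_of hgv hk h
  · refine mem_sectionComap_of hgv (one_mem _) fun w => ?_
    rw [one_smul]
    exact rist_smul_append hg hu.symm huv w

theorem sectionAt_levelRist_le (Γ : Subgroup (treeAut d)) (v : List (Fin d)) :
    sectionAt (levelRist Γ v.length) v ≤ sectionAt (rist Γ v) v := fun k hk => by
  obtain ⟨g, hg, hv, h⟩ := mem_sectionAt.mp hk
  obtain ⟨k', hk', h'⟩ := exists_of_mem_sectionComap (levelRist_le_sectionComap Γ v hg)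
  rwa [treeAut_ext fun w => List.append_cancel_left ((h w).symm.trans (h' w))]

/-- The kernels of the finitely many sections have finite index in `H` and intersect trivially. -/
theorem finite_of_finite_sectionAt (hd : 0 < d) {n : ℕ} {H : Subgroup (treeAut d)}
    (hH : H ≤ levelStab d n) (hfin : ∀ v : List (Fin d), v.length = n → Finite (sectionAt H v)) :
    Finite H := by
  have : Finite {v : List (Fin d) // v.length = n} := List.finite_length_eq (Fin d) n
  have h : (⨅ v : {v : List (Fin d) // v.length = n}, sectionComap v.1 ⊥).relIndex H ≠ 0 :=
    Subgroup.relIndex_iInf_ne_zero fun v =>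
      relIndex_sectionComap_ne_zero (hH.trans (levelStab_le_stabilizer v.2)) <| by
        rw [Subgroup.relIndex_bot_left]
        exact (@Nat.card_pos _ _ (hfin v v.2)).ne'
  refine Subgroup.finite_of_relIndex_ne_zero ?_ h
  have hbot : ⨅ v : {v : List (Fin d) // v.length = n}, sectionComap v.1 ⊥ = ⊥ := by
    refine (Subgroup.eq_bot_iff_forall _).mpr fun g hg => ?_
    refine treeAut_ext_of_level hd n fun v w hv => ?_
    obtain ⟨k, hk, h⟩ := exists_of_mem_sectionComap (Subgroup.mem_iInf.mp hg ⟨v, hv⟩)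
    rw [h, Subgroup.mem_bot.mp hk, one_smul, one_smul]
  rw [hbot]
  infer_instance

theorem fg_sectionAt {H : Subgroup (treeAut d)} (hH : H.FG) (v : List (Fin d)) :
    (sectionAt H v).FG := by
  let St := MulAction.stabilizer (treeAut d) v
  have h1 : (H ⊓ St).FG := Subgroup.fg_of_relIndex_ne_zero inf_le_left
    (by
      rw [Subgroup.inf_relIndex_left]
      exact Subgroup.isFiniteRelIndex_of_finiteIndex.relIndex_ne_zero) hH
  have := (Group.fg_iff_subgroup_fg _).mpr h1
  let f : ↥(H ⊓ St) →* sectionAt H v :=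
    ((sectionHom v).comp (Subgroup.inclusion (inf_le_right : H ⊓ St ≤ St))).codRestrict _
      fun x => ⟨⟨x, x.2.2⟩, x.2.1, rfl⟩
  refine (Group.fg_iff_subgroup_fg _).mp (Group.fg_of_surjective (f := f) ?_)
  rintro ⟨_, g, hg, rfl⟩
  exact ⟨⟨g, hg, g.2⟩, rfl⟩

theorem isOfFinOrder_of_mem_sectionAt {H : Subgroup (treeAut d)}
    (hH : ∀ h ∈ H, IsOfFinOrder h) {v : List (Fin d)} {k : treeAut d} (hk : k ∈ sectionAt H v) :
    IsOfFinOrder k := by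
  obtain ⟨g, hg, rfl⟩ := hk
  exact (sectionHom v).isOfFinOrder (Submonoid.isOfFinOrder_coe.mp (hH g hg))

theorem commute_of_mem_rist {Γ : Subgroup (treeAut d)} {u v : List (Fin d)}
    (h : u.length = v.length) (huv : u ≠ v) {a b : treeAut d} (ha : a ∈ rist Γ u)
    (hb : b ∈ rist Γ v) : a * b = b * a := by
  have key : ∀ {u v : List (Fin d)} {a b : treeAut d}, u.length = v.length → u ≠ v →
      a ∈ rist Γ u → b ∈ rist Γ v → ∀ w, a • b • (v ++ w) = b • a • (v ++ w) :=
    fun {u v a b} h huv ha hb w => by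
      obtain ⟨t, ht, -⟩ := treeAut_smul_append b v w
      rw [mem_levelStab.mp (rist_le_levelStab Γ v hb) v rfl] at ht
      rw [ht, rist_smul_append ha h.symm huv.symm, rist_smul_append ha h.symm huv.symm, ht]
  refine treeAut_ext fun w => ?_
  rw [mul_smul, mul_smul]
  by_cases hv : v <+: w
  · obtain ⟨w, rfl⟩ := hv
    exact key h huv ha hb w
  by_cases hu : u <+: w
  · obtain ⟨w, rfl⟩ := hu
    exact (key h.symm huv.symm hb ha w).symm
  · rw [(mem_rist.mp hb).2 w hv, (mem_rist.mp ha).2 w hu, (mem_rist.mp hb).2 w hv]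

namespace IsBranch

variable {Γ : Subgroup (treeAut d)}

theorem infinite (hΓ : IsBranch Γ) (hd : 2 ≤ d) : Infinite Γ := by
  by_contra hfin
  rw [not_infinite_iff_finite] at hfin
  -- Level `|Γ|` has `d ^ |Γ| > |Γ|` vertices, too many for one orbit.
  let o : List (Fin d) := List.replicate (Nat.card Γ) ⟨0, by omega⟩
  have hsurj : Function.Surjective fun g : Γ =>
      (⟨g • o, by
        change ((g : treeAut d) • o).length = _
        simp [length_treeAut_smul, o]⟩ : List.Vector (Fin d) (Nat.card Γ)) := fun v => by
    obtain ⟨g, hg, h⟩ := hΓ.transitive o v.1 (by simp [o, v.2])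
    exact ⟨⟨g, hg⟩, Subtype.ext h⟩
  have hle := Nat.card_le_card_of_surjective _ hsurj
  change Nat.card (List.Vector (Fin d) (Nat.card Γ)) ≤ _ at hle
  rw [Nat.card_eq_fintype_card, card_vector, Fintype.card_fin] at hle
  exact absurd hle (not_le.mpr (Nat.lt_pow_self (by omega)))

/-- By transitivity the rigid stabilizers of one level are conjugate; if they were finite, so would
be the rigid stabilizer of the level, and then `Γ`. -/
theorem infinite_rist (hΓ : IsBranch Γ) (hd : 2 ≤ d) (v : List (Fin d)) :
    Infinite (rist Γ v) := by
  by_contra hfin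
  rw [not_infinite_iff_finite] at hfin
  have hall : ∀ u : List (Fin d), u.length = v.length → Finite (rist Γ u) := fun u hu => by
    obtain ⟨g, hg, rfl⟩ := hΓ.transitive u v hu
    refine Finite.of_injective (β := rist Γ (g • u)) (fun x => ⟨g * x * g⁻¹, ?_⟩) ?_
    · refine mem_rist.mpr ⟨Γ.mul_mem (Γ.mul_mem hg (mem_rist.mp x.2).1) (Γ.inv_mem hg),
        fun w hw => ?_⟩
      rw [mul_smul, mul_smul, (mem_rist.mp x.2).2, smul_inv_smul]
      intro h
      have h' : g • u <+: g • g⁻¹ • w := g.2.2 _ _ h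
      exact hw (by rwa [smul_inv_smul] at h')
    · intro x y h
      have h' := congrArg Subtype.val h
      simpa using h'
  have hlr : Finite (levelRist Γ v.length) :=
    finite_of_finite_sectionAt (by omega) (levelRist_le_levelStab Γ _) fun u hu => by
      rw [← hu]
      exact Subgroup.finite_of_le (sectionAt_levelRist_le Γ u) (finite_sectionAt (hall u hu) u)
  have := Subgroup.finite_of_relIndex_ne_zero hlr (hΓ.finite_index v.length)
  have := hΓ.infinite hd
  exact not_finite Γ

/-- Otherwise `A` contains some `a` moving a vertex `w` and, rigid stabilizers being infinite, some
`b ≠ 1` supported below `w`. Conjugation by `a` displaces the support of `b`, so they do not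
commute. -/
theorem relIndex_eq_zero_of_commute (hΓ : IsBranch Γ) (hd : 2 ≤ d) {A : Subgroup (treeAut d)}
    (hA : ∀ a ∈ A, ∀ b ∈ A, a * b = b * a) : A.relIndex Γ = 0 := by
  by_contra h
  obtain ⟨a, haA, -, ha1⟩ := Subgroup.exists_ne_one_of_relIndex_ne_zero (hΓ.infinite hd) h
  obtain ⟨w, hw⟩ : ∃ w : List (Fin d), a • w ≠ w := by
    by_contra! hw
    exact ha1 (treeAut_ext fun w => by rw [hw, one_smul])
  obtain ⟨b, hbA, hb, hb1⟩ := Subgroup.exists_ne_one_of_relIndex_ne_zero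
    (hΓ.infinite_rist hd w) fun h0 =>
      h (Subgroup.relIndex_eq_zero_of_le_right (inf_le_left : rist Γ w ≤ Γ) h0)
  refine hb1 (treeAut_ext fun x => ?_)
  rw [one_smul]
  by_cases hx : w <+: x
  · obtain ⟨x, rfl⟩ := hx
    obtain ⟨t, ht, -⟩ := treeAut_smul_append a w x
    refine MulAction.injective a ?_
    change a • b • (w ++ x) = a • (w ++ x)
    rw [← mul_smul, hA a haA b hbA, mul_smul, ht]
    exact rist_smul_append hb (length_treeAut_smul a w) hw t
  · exact (mem_rist.mp hb).2 x hx

theorem sectionAt (hΓ : IsBranch Γ) (v : List (Fin d)) : IsBranch (sectionAt Γ v) where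
  transitive u u' h := by
    obtain ⟨g, hg, hgu⟩ := hΓ.transitive (v ++ u) (v ++ u') (by simp [h])
    obtain ⟨k, hk, hk'⟩ := exists_mem_sectionAt hg (treeAut_smul_left_of_append hgu rfl)
    exact ⟨k, hk, List.append_cancel_left ((hk' u).symm.trans hgu)⟩
  finite_index n := by
    have h := relIndex_sectionAt_ne_zero (hΓ.finite_index (v.length + n)) v
    refine fun h0 => h (Subgroup.relIndex_eq_zero_of_le_left ?_ h0)
    -- Rigid stabilizers of vertices below `v` restrict to rigid stabilizers of the section; the
    -- others act trivially below `v`.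
    have hle : levelRist Γ (v.length + n) ≤
        sectionComap v (levelRist (_root_.sectionAt Γ v) n) := by
      refine iSup₂_le fun z hz g hg => ?_
      obtain ⟨v', u, hv', rfl⟩ := exists_append_of_length_le (n := v.length) (v := z) (by omega)
      have hstab := mem_levelStab.mp (rist_le_levelStab Γ _ hg)
      have hgv : g • v = v := treeAut_smul_left_of_append (w := u) (w' := u)
        (hstab (v ++ u) (by simp [hv'])) rfl
      by_cases hvv : v = v'
      · subst hvv
        obtain ⟨k, hk, h⟩ := exists_mem_sectionAt (mem_rist.mp hg).1 hgv
        refine mem_sectionComap_of hgv ?_ h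
        have hu : u.length = n := by simpa using hz
        rw [← hu]
        refine rist_le_levelRist _ u (mem_rist.mpr ⟨hk, fun w hw => ?_⟩)
        refine List.append_cancel_left ((h w).symm.trans ((mem_rist.mp hg).2 _ ?_))
        rwa [List.prefix_append_right_inj]
      · refine mem_sectionComap_of hgv (one_mem _) fun w => ?_
        rw [one_smul]
        refine (mem_rist.mp hg).2 _ fun hpre => ?_
        exact not_prefix_append_of_ne hv'.symm hvv w ((List.prefix_append v' u).trans hpre)
    intro k hk
    obtain ⟨g, hg, hv, h⟩ := mem_sectionAt.mp hk
    obtain ⟨k', hk', h'⟩ := exists_of_mem_sectionComap (hle hg)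
    rwa [treeAut_ext fun w => List.append_cancel_left ((h w).symm.trans (h' w))]

/-- A self-similar branch group with the subgroup induction property is torsion. -/
theorem isOfFinOrder (hΓ : IsBranch Γ) (hd : 2 ≤ d) (hss : IsSelfSimilar Γ)
    (hind : HasSubgroupInductionProperty Γ) (g : treeAut d) (hg : g ∈ Γ) : IsOfFinOrder g := by
  obtain ⟨n, hn⟩ := exists_level_sectionAt_finite_or_relIndex_ne_zero hss hind
    (H := Subgroup.zpowers g) (by simpa using hg) ⟨{g}, by simp [Subgroup.zpowers_eq_closure]⟩
  have hfin : ∀ v : List (Fin d), v.length = n →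
      Finite (_root_.sectionAt (Subgroup.zpowers g ⊓ levelStab d n) v) := fun v hv => by
    -- Sections of a cyclic group are abelian, which excludes finite index in a branch group.
    refine Subgroup.finite_of_le (sectionAt_mono inf_le_left v) ((hn v hv).resolve_right fun h => ?_)
    refine h ((hΓ.sectionAt v).relIndex_eq_zero_of_commute hd ?_)
    rintro _ ⟨a, ha, rfl⟩ _ ⟨b, hb, rfl⟩
    rw [← map_mul, ← map_mul]
    congr 1
    obtain ⟨i, hi⟩ := ha
    obtain ⟨j, hj⟩ := hb
    refine Subtype.ext ?_
    change (a : treeAut d) * b = b * a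
    rw [show (a : treeAut d) = g ^ i from hi.symm, show (b : treeAut d) = g ^ j from hj.symm,
      zpow_mul_comm]
  have h1 := finite_of_finite_sectionAt (by omega) inf_le_right hfin
  have h2 : Finite (Subgroup.zpowers g) := Subgroup.finite_of_relIndex_ne_zero h1 <| by
    rw [Subgroup.inf_relIndex_left]
    exact Subgroup.isFiniteRelIndex_of_finiteIndex.relIndex_ne_zero
  exact finite_zpowers.mp h2

end IsBranch

end Branch

/-! ### Subgroups normalized by a subgroup of finite index -/

section Separability

open scoped commutatorElement

variable {d : ℕ}

theorem isSeparableSubgroup_bot_of_treeAut (Γ : Subgroup (treeAut d)) :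
    IsSeparableSubgroup (⊥ : Subgroup Γ) := fun x hx => by
  obtain ⟨w, hw⟩ : ∃ w : List (Fin d), (x : treeAut d) • w ≠ w := by
    by_contra! hw
    exact hx (Subtype.ext (treeAut_ext fun w => by rw [hw]; exact (one_smul _ w).symm))
  exact ⟨(MulAction.stabilizer (treeAut d) w).comap Γ.subtype,
    (finiteIndex_stabilizer_treeAut w).comap _, bot_le, hw⟩

theorem isSeparableSubgroup_of_finite {Γ : Subgroup (treeAut d)} {N : Subgroup Γ}
    (hN : Finite N) : IsSeparableSubgroup N :=
  (isSeparableSubgroup_bot_of_treeAut Γ).of_relIndex_ne_zero bot_le <| by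
    rw [Subgroup.relIndex_bot_left]
    exact (@Nat.card_pos _ _ hN).ne'

/-- A normal subgroup of finite index of a group that is transitive on the levels is transitive on
the levels of the subtrees hanging from the vertices of some level. -/
theorem exists_level_transitive_of_normal {Γ : Subgroup (treeAut d)} (hd : 0 < d)
    (htr : ∀ u v : List (Fin d), u.length = v.length → ∃ g ∈ Γ, g • u = v) (K : Subgroup Γ)
    [K.Normal] [hK : K.FiniteIndex] : ∃ m, ∀ u w w' : List (Fin d), u.length = m →
      w.length = w'.length → ∃ k ∈ K, (k : treeAut d) • (u ++ w) = u ++ w' := by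
  let o : ℕ → List (Fin d) := fun n => List.replicate n ⟨0, hd⟩
  let S : ℕ → Subgroup Γ := fun n => (MulAction.stabilizer (treeAut d) (o n)).comap Γ.subtype
  let f : ℕ → ℕ := fun n => (K ⊔ S n).index
  -- The indices of `K ⊔ S n` are bounded by that of `K`; beyond a level `m` attaining the maximum,
  -- this subgroup is constant.
  have hb : BddAbove (Set.range f) := ⟨K.index, by
    rintro _ ⟨n, rfl⟩
    exact Subgroup.index_antitone le_sup_left⟩
  obtain ⟨m, hm⟩ := Nat.sSup_mem (Set.range_nonempty f) hb
  have hmax : ∀ n, f n ≤ f m := fun n => hm ▸ le_csSup hb ⟨n, rfl⟩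
  have ho : ∀ n, o (m + n) = o m ++ o n := fun n => List.replicate_add _ _ _
  have hS : ∀ n, S (m + n) ≤ S m := fun n g hg =>
    treeAut_smul_left_of_append (w := o n) (w' := o n) (by rw [← ho]; exact hg) rfl
  have heq : ∀ n, K ⊔ S (m + n) = K ⊔ S m := fun n => by
    by_contra hne
    have hlt : K ⊔ S (m + n) < K ⊔ S m := lt_of_le_of_ne (sup_le_sup_left (hS n) K) hne
    have : (K ⊔ S (m + n)).FiniteIndex := Subgroup.finiteIndex_of_le le_sup_left
    exact absurd (Subgroup.index_strictAnti hlt) (not_lt.mpr (hmax (m + n)))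
  refine ⟨m, fun u w w' hu hw => ?_⟩
  obtain ⟨g, hg, hgw⟩ := htr (o (m + w.length)) (u ++ w) (by simp [o, hu])
  obtain ⟨g', hg', hgw'⟩ := htr (o (m + w.length)) (u ++ w') (by simp [o, hu, hw])
  have hgu : g • o m = u := treeAut_smul_left_of_append (by rw [← ho, hgw]) (by simp [o, hu])
  have hgu' : g' • o m = u := treeAut_smul_left_of_append (by rw [← ho, hgw']) (by simp [o, hu])
  have hs : (⟨g, hg⟩ : Γ)⁻¹ * ⟨g', hg'⟩ ∈ S m := by
    change (g⁻¹ * g') • o m = o m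
    rw [mul_smul, hgu', inv_smul_eq_iff, hgu]
  have hs' : (⟨g, hg⟩ : Γ)⁻¹ * ⟨g', hg'⟩ ∈ K ⊔ S (m + w.length) :=
    (heq _).symm ▸ Subgroup.mem_sup_right hs
  -- Up to some `z` fixing the deep vertex, `g⁻¹ * g'` lies in `K`; the conjugate of `k` by `g` is
  -- the required element.
  obtain ⟨k, hk, z, hz, hkz⟩ := Subgroup.mem_sup_of_normal_left.mp hs'
  refine ⟨⟨g, hg⟩ * k * ⟨g, hg⟩⁻¹, Subgroup.Normal.conj_mem inferInstance k hk _, ?_⟩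
  have hz' : (z : treeAut d) • o (m + w.length) = o (m + w.length) := hz
  have hkz' : (k : treeAut d) * z = g⁻¹ * g' := congrArg Subtype.val hkz
  change (g * k * g⁻¹) • (u ++ w) = u ++ w'
  rw [← hgw, mul_smul, inv_smul_smul]
  nth_rw 1 [← hz']
  rw [← mul_smul, mul_assoc, hkz', mul_inv_cancel_left, hgw']

/-- In `⁅a, n⁆ = a * (n * a⁻¹ * n⁻¹)` the second factor is supported below `n • v ≠ v`, so it
commutes with `b`. Hence `⁅⁅a, n⁆, b⁆ = ⁅a, b⁆`, and the left side is in `N` because `K` normalizes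
`N`. -/
theorem commutator_mem_of_moves {Γ K N : Subgroup (treeAut d)}
    (hKN : ∀ k ∈ K, ∀ n ∈ N, k * n * k⁻¹ ∈ N) {v : List (Fin d)} {n : treeAut d} (hn : n ∈ N)
    (hnv : n • v ≠ v) {a b : treeAut d} (ha : a ∈ K ⊓ rist Γ v) (hb : b ∈ K ⊓ rist Γ v) :
    ⁅a, b⁆ ∈ N := by
  have h1 : ⁅a, n⁆ ∈ N := by
    rw [commutatorElement_def]
    exact N.mul_mem (hKN a ha.1 n hn) (N.inv_mem hn)
  have h2 : ⁅⁅a, n⁆, b⁆ ∈ N := by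
    rw [commutatorElement_def, mul_assoc, mul_assoc, ← mul_assoc b]
    exact N.mul_mem h1 (hKN b hb.1 _ (N.inv_mem h1))
  have hc : n * a⁻¹ * n⁻¹ ∈ rist ⊤ (n • v) := by
    refine mem_rist.mpr ⟨trivial, fun w hw => ?_⟩
    have ha' : a⁻¹ ∈ rist Γ v := inv_mem ha.2
    rw [mul_smul, mul_smul, (mem_rist.mp ha').2, smul_inv_smul]
    intro h
    have h' : n • v <+: n • n⁻¹ • w := n.2.2 _ _ h
    exact hw (by rwa [smul_inv_smul] at h')
  have hb' : b ∈ rist ⊤ v := mem_rist.mpr ⟨trivial, (mem_rist.mp hb.2).2⟩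
  have hcomm := commute_of_mem_rist (length_treeAut_smul n v) hnv hc hb'
  have h3 : ⁅⁅a, n⁆, b⁆ = ⁅a, b⁆ := by
    have h4 : ⁅a, n⁆ = a * (n * a⁻¹ * n⁻¹) := by simp only [commutatorElement_def, mul_assoc]
    rw [h4]
    generalize n * a⁻¹ * n⁻¹ = c at hcomm
    calc ⁅a * c, b⁆ = a * (c * b) * c⁻¹ * a⁻¹ * b⁻¹ := by
          simp only [commutatorElement_def, mul_inv_rev, mul_assoc]
      _ = ⁅a, b⁆ := by
          rw [hcomm]
          simp only [commutatorElement_def, mul_assoc, mul_inv_cancel_left]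
  exact h3 ▸ h2

/-- Below some level, a subgroup that is normalized by a subgroup of finite index of a group
transitive on the levels either moves a vertex or fixes all of its descendants. -/
theorem exists_level_moves_or_fixes {Γ : Subgroup (treeAut d)} (hd : 0 < d)
    (htr : ∀ u v : List (Fin d), u.length = v.length → ∃ g ∈ Γ, g • u = v) (K N : Subgroup Γ)
    [hK : K.FiniteIndex] (hKN : ∀ k ∈ K, ∀ n ∈ N, k * n * k⁻¹ ∈ N) :
    ∃ l, ∀ v : List (Fin d), v.length = l → (∃ n ∈ N, (n : treeAut d) • v ≠ v) ∨
      ∀ n ∈ N, ∀ w, (n : treeAut d) • (v ++ w) = v ++ w := by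
  obtain ⟨m, hm⟩ := exists_level_transitive_of_normal hd htr K.normalCore
  have hex : ∀ u : List (Fin d), ∃ w₀ : List (Fin d),
      (∃ n ∈ N, ∃ w, (n : treeAut d) • (u ++ w) ≠ u ++ w) →
        ∃ n ∈ N, (n : treeAut d) • (u ++ w₀) ≠ u ++ w₀ := fun u => by
    by_cases h : ∃ n ∈ N, ∃ w, (n : treeAut d) • (u ++ w) ≠ u ++ w
    · obtain ⟨n, hn, w, hw⟩ := h
      exact ⟨w, fun _ => ⟨n, hn, hw⟩⟩
    · exact ⟨[], fun h' => absurd h' h⟩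
  choose f hf using hex
  obtain ⟨B, hB⟩ := ((List.finite_length_eq (Fin d) m).image fun u => (f u).length).bddAbove
  refine ⟨m + B, fun v hv => ?_⟩
  obtain ⟨u, w, hu, rfl⟩ := exists_append_of_length_le (n := m) (v := v) (by omega)
  by_cases h : ∃ n ∈ N, ∃ w, (n : treeAut d) • (u ++ w) ≠ u ++ w
  · left
    obtain ⟨n, hn, hnw⟩ := hf u h
    have hfB : (f u).length ≤ B := hB ⟨u, hu, rfl⟩
    simp only [List.length_append] at hv
    obtain ⟨w₁, w₂, hw₁, rfl⟩ := exists_append_of_length_le (n := (f u).length) (v := w) (by omega)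
    -- `K` carries the moved vertex `u ++ f u` to a prefix of the given vertex; a conjugate of `n`
    -- moves this prefix, hence the vertex.
    obtain ⟨k, hk, hkw⟩ := hm u (f u) w₁ hu hw₁.symm
    refine ⟨k * n * k⁻¹, hKN k (Subgroup.normalCore_le K hk) n hn, fun hfix => hnw ?_⟩
    rw [← List.append_assoc] at hfix
    have h1 : ((k : treeAut d) * n * (k : treeAut d)⁻¹) • (u ++ w₁) = u ++ w₁ :=
      treeAut_smul_left_of_append hfix rfl
    rw [← hkw, mul_smul, mul_smul, inv_smul_smul] at h1
    exact MulAction.injective (k : treeAut d) h1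
  · right
    push Not at h
    exact fun n hn x => by simpa using h n hn (w ++ x)

/-- In a finitely generated torsion branch group, the subgroups that are normalized by a subgroup
of finite index are separable. -/
theorem IsBranch.isSeparableSubgroup_of_normalized {Γ : Subgroup (treeAut d)} (hΓ : IsBranch Γ)
    (hd : 2 ≤ d) (hfg : Γ.FG) (htor : ∀ g ∈ Γ, IsOfFinOrder g) (K N : Subgroup Γ)
    (hK : K.FiniteIndex) (hKN : ∀ k ∈ K, ∀ n ∈ N, k * n * k⁻¹ ∈ N) : IsSeparableSubgroup N := by
  obtain ⟨l, hl⟩ := exists_level_moves_or_fixes (by omega) hΓ.transitive K N hKN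
  let K' := K.map Γ.subtype
  let N' := N.map Γ.subtype
  have hKN' : ∀ k ∈ K', ∀ n ∈ N', k * n * k⁻¹ ∈ N' := by
    rintro _ ⟨k, hk, rfl⟩ _ ⟨n, hn, rfl⟩
    exact ⟨_, hKN k hk n hn, rfl⟩
  have hK' : K'.relIndex Γ ≠ 0 := by
    have h : (K.map Γ.subtype).subgroupOf Γ = K :=
      Subgroup.comap_map_eq_self_of_injective Γ.subtype_injective K
    rw [Subgroup.relIndex, h]
    exact hK.index_ne_zero
  let S : List (Fin d) → Subgroup (treeAut d) := fun v => _root_.sectionAt (K' ⊓ rist Γ v) v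
  have hSN : ∀ v, (∃ n ∈ N, (n : treeAut d) • v ≠ v) →
      ⁅S v, S v⁆ ≤ _root_.sectionAt (N' ⊓ rist Γ v) v := by
    rintro v ⟨n, hn, hnv⟩
    simp only [S, _root_.sectionAt]
    rw [← Subgroup.map_commutator]
    refine Subgroup.map_mono (Subgroup.commutator_le.mpr fun a ha b hb => ?_)
    refine ⟨commutator_mem_of_moves hKN' ⟨n, hn, rfl⟩ hnv ha hb, ?_⟩
    have ha' : (a : treeAut d) ∈ rist Γ v := ha.2
    have hb' : (b : treeAut d) ∈ rist Γ v := hb.2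
    change ⁅(a : treeAut d), (b : treeAut d)⁆ ∈ rist Γ v
    rw [commutatorElement_def]
    exact mul_mem (mul_mem (mul_mem ha' hb') (inv_mem ha')) (inv_mem hb')
  -- Where `N` moves `v`, the section at `v` of an element of `M` is also the section of an element
  -- of `N` supported below `v`.
  let M : Subgroup (treeAut d) := levelRist Γ l ⊓
    ⨅ v : {v : List (Fin d) // v.length = l}, sectionComap v.1 ⁅S v, S v⁆
  have hM : M.relIndex Γ ≠ 0 := by
    have : Finite {v : List (Fin d) // v.length = l} := List.finite_length_eq (Fin d) l
    refine Subgroup.relIndex_ne_zero_trans (K := levelRist Γ l) ?_ (hΓ.finite_index l)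
    rw [Subgroup.inf_relIndex_left]
    refine Subgroup.relIndex_iInf_ne_zero fun ⟨v, hv⟩ => ?_
    subst hv
    refine relIndex_sectionComap_ne_zero
      ((levelRist_le_levelStab Γ _).trans (levelStab_le_stabilizer rfl)) ?_
    have hSi : (S v).relIndex (_root_.sectionAt (levelRist Γ v.length) v) ≠ 0 := by
      have h1 : (K' ⊓ rist Γ v).relIndex (rist Γ v) ≠ 0 := by
        rw [Subgroup.inf_relIndex_right]
        exact fun h0 => hK' (Subgroup.relIndex_eq_zero_of_le_right inf_le_left h0)
      exact fun h0 => relIndex_sectionAt_ne_zero h1 v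
        (Subgroup.relIndex_eq_zero_of_le_right (sectionAt_levelRist_le Γ v) h0)
    refine Subgroup.relIndex_ne_zero_trans (Subgroup.relIndex_commutator_ne_zero ?_ ?_) hSi
    · refine Subgroup.fg_of_relIndex_ne_zero
        (sectionAt_mono (inf_le_right.trans (rist_le_levelRist Γ v)) v) hSi ?_
      exact fg_sectionAt
        (Subgroup.fg_of_relIndex_ne_zero levelRist_le (hΓ.finite_index v.length) hfg) v
    · exact fun q hq => isOfFinOrder_of_mem_sectionAt
        (H := K' ⊓ rist Γ v) (fun h hh => htor h (mem_rist.mp hh.2).1) hq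
  have key : ∀ x : Γ, (x : treeAut d) ∈ M →
      (∀ z : List (Fin d), (∀ n ∈ N, (n : treeAut d) • z = z) → (x : treeAut d) • z = z) →
      x ∈ N := by
    intro x hx hfix
    -- Where `N` acts trivially below `v`, so does `x` by `hfix`, and the local piece is `1`.
    have hloc : ∀ v : List (Fin d), v.length = l →
        ∃ r ∈ N' ⊓ rist Γ v, ∀ w, r • (v ++ w) = (x : treeAut d) • (v ++ w) := by
      intro v hv
      rcases hl v hv with h | h
      · obtain ⟨c, hc, hxc⟩ := exists_of_mem_sectionComap (Subgroup.mem_iInf.mp hx.2 ⟨v, hv⟩)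
        obtain ⟨r, hr, -, hrc⟩ := mem_sectionAt.mp (hSN v h hc)
        exact ⟨r, hr, fun w => (hrc w).trans (hxc w).symm⟩
      · exact ⟨1, one_mem _, fun w => by rw [one_smul, hfix _ fun n hn => h n hn w]⟩
    have hxl := mem_levelStab.mp (levelRist_le_levelStab Γ l hx.1)
    -- The product of the local pieces rebuilds `x` inside `N`.
    have hprod : ∀ s : Finset (List (Fin d)), (∀ v ∈ s, v.length = l) → ∃ p ∈ N',
        (∀ v ∈ s, ∀ w, p • (v ++ w) = (x : treeAut d) • (v ++ w)) ∧
        ∀ v, v.length = l → v ∉ s → ∀ w, p • (v ++ w) = v ++ w := by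
      classical
      intro s
      induction s using Finset.induction_on with
      | empty => exact fun _ => ⟨1, one_mem _, by simp, fun v _ _ w => one_smul _ _⟩
      | insert v s hvs IH =>
        intro hs
        obtain ⟨p, hp, hps, hpn⟩ := IH fun u hu => hs u (Finset.mem_insert_of_mem hu)
        have hv := hs v (Finset.mem_insert_self v s)
        obtain ⟨r, hr, hrx⟩ := hloc v hv
        refine ⟨p * r, mul_mem hp hr.1, fun u hu w => ?_, fun u hu hus w => ?_⟩
        · rw [mul_smul]
          rcases Finset.mem_insert.mp hu with rfl | hu'
          · obtain ⟨t, ht, -⟩ := treeAut_smul_append (x : treeAut d) u w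
            rw [hxl u hv] at ht
            rw [hrx, ht, hpn u hv hvs]
          · have hne : u ≠ v := fun h => hvs (h ▸ hu')
            rw [rist_smul_append hr.2 ((hs u hu).trans hv.symm) hne, hps u hu']
        · rw [Finset.mem_insert, not_or] at hus
          rw [mul_smul, rist_smul_append hr.2 (hu.trans hv.symm) hus.1, hpn u hu hus.2]
    have hfin := List.finite_length_eq (Fin d) l
    obtain ⟨p, ⟨n, hn, hnp⟩, hpx, -⟩ := hprod hfin.toFinset fun v hv => by simpa using hv
    have hpx' : p = x := treeAut_ext_of_level (by omega) l fun v w hv =>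
      hpx v (by simpa using hv) w
    rwa [← Subtype.ext (hnp.trans hpx')]
  have hMΓ : (M.subgroupOf Γ).FiniteIndex := ⟨hM⟩
  refine IsSeparableSubgroup.of_relIndex_ne_zero (H := N ⊓ M.subgroupOf Γ) (fun x hx => ?_)
    inf_le_left ?_
  · by_cases hxM : (x : treeAut d) ∈ M
    · have hxN : x ∉ N := fun h => hx ⟨h, hxM⟩
      have h := mt (key x hxM) hxN
      push Not at h
      obtain ⟨z, hz, hxz⟩ := h
      exact ⟨(MulAction.stabilizer (treeAut d) z).comap Γ.subtype,
        (finiteIndex_stabilizer_treeAut z).comap _, fun n hn => hz n hn.1, hxz⟩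
    · exact ⟨M.subgroupOf Γ, hMΓ, inf_le_right, hxM⟩
  · rw [Subgroup.inf_relIndex_left]
    exact Subgroup.isFiniteRelIndex_of_finiteIndex.relIndex_ne_zero

end Separability

/-! ### Subgroup separability -/

theorem theorem3 {d : ℕ} (hd : 2 ≤ d) (G : Subgroup (treeAut d)) (hfg : G.FG)
    (hss : IsSelfSimilar G) (hbranch : IsBranch G) (hcsp : HasCongruenceSubgroupProperty G)
    (hind : HasSubgroupInductionProperty G) : IsSubgroupSeparable G := by
  intro H hH
  refine IsSeparableSubgroup.isClosed ?_
  let T := H.map G.subtype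
  have hTG : T ≤ G := Subgroup.map_subtype_le H
  have hT : T.FG := by
    have := (Group.fg_iff_subgroup_fg H).mpr hH
    exact (Group.fg_iff_subgroup_fg T).mp
      (Group.fg_of_surjective (MonoidHom.subgroupMap_surjective G.subtype H))
  obtain ⟨n, hn⟩ := exists_level_sectionAt_finite_or_relIndex_ne_zero hss hind hTG hT
  have hfinV : Finite {v : List (Fin d) // v.length = n} := List.finite_length_eq (Fin d) n
  let D : Subgroup G := (levelStab d n).comap G.subtype
  have hD : D.FiniteIndex := (finiteIndex_levelStab n).comap _
  refine IsSeparableSubgroup.of_relIndex_ne_zero (H := H ⊓ D) ?_ inf_le_left (by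
    rw [Subgroup.inf_relIndex_left]
    exact Subgroup.isFiniteRelIndex_of_finiteIndex.relIndex_ne_zero)
  refine IsSeparableSubgroup.of_subgroupOf inf_le_right ?_
  -- The target is the section of `G` at `v`, not `G`, since the finite-index alternative is
  -- relative to that section.
  let ψ : ∀ v : {v : List (Fin d) // v.length = n}, D →* sectionAt G v := fun v =>
    ((sectionHom v.1).comp ((G.subtype.comp D.subtype).codRestrict
      (MulAction.stabilizer (treeAut d) v.1) fun x =>
        levelStab_le_stabilizer v.2 x.2)).codRestrict _ fun x =>
          ⟨⟨x.1, levelStab_le_stabilizer v.2 x.2⟩, x.1.2, rfl⟩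
  have hψ : ∀ v (x : D) w, ((x : G) : treeAut d) • (v.1 ++ w) = v.1 ++ (ψ v x : treeAut d) • w :=
    fun v x w => (append_drop_smul_of_stab v.1 ⟨x, levelStab_le_stabilizer v.2 x.2⟩ w).symm
  have hinj : Function.Injective (MonoidHom.pi ψ) := fun x y hxy => by
    refine Subtype.ext (Subtype.ext (treeAut_ext_of_level (by omega) n fun v w hv => ?_))
    refine (hψ ⟨v, hv⟩ x w).trans (Eq.trans ?_ (hψ ⟨v, hv⟩ y w).symm)
    have h : ψ ⟨v, hv⟩ x = ψ ⟨v, hv⟩ y := congrFun hxy ⟨v, hv⟩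
    rw [h]
  refine IsSeparableSubgroup.of_map hinj (isSeparableSubgroup_of_pi ?_ _ fun v => ?_)
  · rintro v K N (hK | hK) hNK hKN
    · exact isSeparableSubgroup_of_finite (Subgroup.finite_of_le hNK hK)
    · exact (hbranch.sectionAt v.1).isSeparableSubgroup_of_normalized hd (fg_sectionAt hfg v.1)
        (fun g hg => isOfFinOrder_of_mem_sectionAt (hbranch.isOfFinOrder hd hss hind) hg)
        K N hK hKN
  · have hmap : (((H ⊓ D).subgroupOf D).map (MonoidHom.pi ψ)).map (Pi.evalMonoidHom _ v) =
        (sectionAt (T ⊓ levelStab d n) v.1).subgroupOf (sectionAt G v.1) := by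
      rw [Subgroup.map_map]
      ext k
      constructor
      · rintro ⟨x, hx, rfl⟩
        exact mem_sectionAt.mpr ⟨x, ⟨⟨x.1, hx.1, rfl⟩, x.2⟩,
          mem_levelStab.mp x.2 v.1 v.2, hψ v x⟩
      · intro hk
        obtain ⟨g, ⟨⟨h, hh, rfl⟩, hgD⟩, -, hgk⟩ := mem_sectionAt.mp hk
        refine ⟨⟨h, hgD⟩, ⟨hh, hgD⟩, Subtype.ext (treeAut_ext fun w => ?_)⟩
        exact List.append_cancel_left ((hψ v ⟨h, hgD⟩ w).symm.trans (hgk w))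
    rw [hmap]
    have hle : sectionAt (T ⊓ levelStab d n) v.1 ≤ sectionAt T v.1 :=
      sectionAt_mono inf_le_left v.1
    have hi : (T ⊓ levelStab d n).relIndex T ≠ 0 := by
      rw [Subgroup.inf_relIndex_left]
      exact Subgroup.isFiniteRelIndex_of_finiteIndex.relIndex_ne_zero
    refine (Subgroup.finite_or_relIndex_ne_zero_of_le hle (relIndex_sectionAt_ne_zero hi v.1)
      (hn v.1 v.2)).imp (fun hf => ?_) fun h => ⟨h⟩
    exact @Finite.of_injective _ _ hf _
      (Subgroup.subgroupOfEquivOfLe (sectionAt_mono (inf_le_left.trans hTG) v.1)).injective
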